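/- Let $(\mathbf K,\otimes,\mathbf 1)$ be a compactly generated tensor triangulated category: $\mathbf K$ is a triangulated category with shift $\Sigma$ and all set-indexed coproducts, with a symmetric monoidal product $\otimes$ that is exact in each variable; the isomorphism classes of compact objects form a set; every nonzero object receives a nonzero morphism from a compact object; $\mathbf 1$ is compact; and every compact object $M$ is rigid, with dual $M^*$. Let $\mathbf K^c\subseteq\mathbf K$ be the full subcategory of compact objects, i.e. of those $M$ for which $\operatorname{Hom}_{\mathbf K}(M,-)$ commutes with set-indexed coproducts. Let $X$ be a Zariski space: a Noetherian topological space in which every irreducible closed subset has a unique generic point. Let $\mathcal X$ be the set of closed subsets of $X$ and $\mathcal X_{sp}$ the set of unions of closed subsets of $X$ (the specialization closed subsets). For $\mathbf L=\mathbf K^c$ or $\mathbf L=\mathbf K$ and a set $\hat{\mathcal X}$ of subsets of $X$, a support data is an assignment $V:\mathbf L\to\hat{\mathcal X}$ on objects such that, for objects of $\mathbf L$: 1. $V(0)=\varnothing$ and $V(\mathbf 1)=X$; 2. $V(\bigoplus_{i\in I}M_i)=\bigcup_{i\in I}V(M_i)$ whenever $\bigoplus_{i\in I}M_i$ is an object of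 $\mathbf L$; 3. $V(\Sigma M)=V(M)$; 4. $V(N)\subseteq V(M)\cup V(Q)$ for every distinguished triangle $M\to N\to Q\to\Sigma M$; 5. $V(M\otimes N)=V(M)\cap V(N)$; 6. $V(M)=V(M^*)$ for $M$ compact. Let $V:\mathbf K^c\to\mathcal X$ be a support data which satisfies faithfulness ($V(M)=\varnothing$ if and only if $M=0$) and realization (for every $W\in\mathcal X$ there is $M\in\mathbf K^c$ with $V(M)=W$). Assume that there is a support data $\mathcal V:\mathbf K\to\mathcal X_{sp}$ which extends $V$, that is, $\mathcal V$ satisfies (1)--(5) on $\mathbf K$; $\mathcal V(M)=V(M)$ for all $M\in\mathbf K^c$; and, if $V$ satisfies faithfulness, so does $\mathcal V$ (on $\mathbf K$). Then there is a homeomorphism $$f: X\longrightarrow \operatorname{Spc}(\mathbf K^c).$$ Here $\operatorname{Spc}(\mathbf K^c)$ is the Balmer spectrum: the set of prime ideals of $\mathbf K^c$, i.e. of proper thick tensor ideals $\mathbf P\subsetneq\mathbf K^c$ such that $M\otimes N\in\mathbf P$ implies $M\in\mathbf P$ or $N\in\mathbf P$, with closed sets $Z(\mathcal C)=\{\mathbf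 P\mid \mathcal C\cap\mathbf P=\varnothing\}$ for families $\mathcal C$ of objects of $\mathbf K^c$. -/

import Mathlib

open CategoryTheory CategoryTheory.Limits MonoidalCategory Opposite TopologicalSpace

universe v u w

namespace TensorTriangular

section Compact

variable (C : Type u) [Category.{v} C] [Preadditive C]

/-- The compact objects of `C`: those `M` for which the abelian-group-valued functor `Hom(M, -)`
commutes with set-indexed coproducts. As a full subcategory this is `K^c`. -/
def compactObjects : ObjectProperty C := fun M =>
  ∀ J : Type v, PreservesColimitsOfShape (Discrete J) (preadditiveCoyoneda.obj (op M))

end Compact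

section Categories

variable (C : Type u) [Category.{v} C] [Preadditive C] [HasZeroObject C] [HasShift C ℤ]
  [∀ n : ℤ, (shiftFunctor C n).Additive] [Pretriangulated C]

/-- A compactly generated triangulated category: it has set-indexed coproducts, the isomorphism
classes of compact objects form a set, and every nonzero object receives a nonzero morphism from
a compact object. -/
structure IsCompactlyGenerated : Prop where
  hasCoproducts : HasCoproducts.{v} C
  essentiallySmall : ObjectProperty.EssentiallySmall.{v} (compactObjects C)
  exists_ne_zero : ∀ M : C, ¬ IsZero M → ∃ N : C, compactObjects C N ∧ ∃ f : N ⟶ M, f ≠ 0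

variable [MonoidalCategory C]

/-- The monoidal product of the triangulated category `C` is exact in each variable; when the
monoidal structure is symmetric, `C` is then a tensor triangulated category. An exact functor is one which commutes with the shift
up to a natural isomorphism and (through this isomorphism) preserves distinguished triangles. -/
structure IsTensorTriangulated : Prop where
  exact_left : ∀ M : C, ∃ _ : (tensorLeft M).CommShift ℤ, (tensorLeft M).IsTriangulated
  exact_right : ∀ M : C, ∃ _ : (tensorRight M).CommShift ℤ, (tensorRight M).IsTriangulated

/-- A compactly generated tensor triangulated category: the unit is compact and every compact
object is rigid (strongly dualizable). -/
structure IsCompactlyGeneratedTTC : Prop where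
  isTensorTriangulated : IsTensorTriangulated C
  isCompactlyGenerated : IsCompactlyGenerated C
  unit_compact : compactObjects C (𝟙_ C)
  rigid : ∀ M : C, compactObjects C M → ∃ M' : C, Nonempty (ExactPairing M M')

end Categories

section Spectrum

variable {C : Type u} [Category.{v} C] [Preadditive C] [HasZeroObject C] [HasShift C ℤ]
  [∀ n : ℤ, (shiftFunctor C n).Additive] [Pretriangulated C] [MonoidalCategory C]

/-- `P` is a thick tensor ideal of the thick tensor triangulated subcategory `S` of `C`
(for instance `S = ⊤`, i.e. `C` itself, or `S = compactObjects C`, i.e. `K^c`). -/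
structure IsThickTensorIdeal (S P : ObjectProperty C) : Prop where
  le : P ≤ S
  isTriangulated : P.IsTriangulated
  isThick : P.IsStableUnderRetracts
  tensor_mem : ∀ M N : C, P M → S N → P (M ⊗ N)

/-- `P` is a prime ideal of `S`: a proper thick tensor ideal such that `M ⊗ N ∈ P` implies
`M ∈ P` or `N ∈ P`. -/
structure IsPrimeIdeal (S P : ObjectProperty C) : Prop extends IsThickTensorIdeal S P where
  proper : ∃ M : C, S M ∧ ¬ P M
  prime : ∀ M N : C, S M → S N → P (M ⊗ N) → P M ∨ P N

/-- The Balmer spectrum of the thick tensor triangulated subcategory `S` of `C`, as a set: the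
set of all prime ideals of `S`. -/
def Spc (S : ObjectProperty C) : Type u := {P : ObjectProperty C // IsPrimeIdeal S P}

/-- `Z(𝒞)` is the set of primes containing no member of the family `𝒞`. (Objects outside `S`
lie in no prime of `S`, so it is harmless to allow them in `𝒞`.) -/
def Spc.Z (S : ObjectProperty C) (𝒞 : Set C) : Set (Spc S) := {P | ∀ M ∈ 𝒞, ¬ P.1 M}

/-- The topology on the Balmer spectrum: the closed sets are exactly the sets `Z(𝒞)`. -/
instance (S : ObjectProperty C) : TopologicalSpace (Spc S) :=
  TopologicalSpace.ofClosed (Set.range (Spc.Z S))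
    (by
      refine ⟨Set.univ, Set.eq_empty_iff_forall_notMem.2 fun P hP => ?_⟩
      have := P.2.isTriangulated
      obtain ⟨M, -, hM⟩ := P.1.exists_prop_of_containsZero
      exact hP M trivial hM)
    (by
      intro A hA
      refine ⟨⋃₀ {𝒞 | Spc.Z S 𝒞 ∈ A}, Set.ext fun P => ⟨fun hP B hB => ?_, fun hP M hM => ?_⟩⟩
      · obtain ⟨𝒞, rfl⟩ := hA hB
        exact fun M hM => hP M ⟨𝒞, hB, hM⟩
      · obtain ⟨𝒞, h𝒞, hM⟩ := hM
        exact hP _ h𝒞 M hM)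
    (by
      rintro _ ⟨𝒞, rfl⟩ _ ⟨𝒟, rfl⟩
      refine ⟨{E | ∃ M ∈ 𝒞, ∃ N ∈ 𝒟, E = (M ⊞ N)}, Set.ext fun P => ⟨fun hP => ?_, ?_⟩⟩
      · by_contra h
        simp only [Spc.Z, Set.mem_union, Set.mem_ofPred_eq, not_or, not_forall, not_not] at h
        obtain ⟨⟨M, hM, hPM⟩, N, hN, hPN⟩ := h
        have := P.2.isTriangulated
        have := P.2.isThick
        exact hP _ ⟨M, hM, N, hN, rfl⟩
          (P.1.ext_of_isTriangulatedClosed₂ _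
            (Pretriangulated.binaryBiproductTriangle_distinguished M N) hPM hPN)
      · rintro (h | h) _ ⟨M, hM, N, hN, rfl⟩ hE
        · have := P.2.isThick
          exact h M hM (P.1.prop_of_retract
            { i := biprod.inl, r := biprod.fst } hE)
        · have := P.2.isThick
          exact h N hN (P.1.prop_of_retract
            { i := biprod.inr, r := biprod.snd } hE))

end Spectrum

section Spaces

variable (X : Type w) [TopologicalSpace X]

/-- A Zariski space: a Noetherian space in which every irreducible closed set has a unique
generic point. -/
structure IsZariskiSpace : Prop where
  noetherian : NoetherianSpace X
  existsUnique_genericPoint : ∀ Y : Set X, IsIrreducible Y → IsClosed Y → ∃! y, closure {y} = Y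

/-- The closed subsets of `X`. -/
def closedSubsets : Set (Set X) := {W | IsClosed W}

/-- The specialization closed subsets of `X`: the unions of closed subsets. -/
def specializationClosedSubsets : Set (Set X) :=
  {W | ∃ 𝒲 : Set (Set X), (∀ Z ∈ 𝒲, IsClosed Z) ∧ W = ⋃₀ 𝒲}

end Spaces

section Support

variable {C : Type u} [Category.{v} C] [Preadditive C] [HasZeroObject C] [HasShift C ℤ]
  [∀ n : ℤ, (shiftFunctor C n).Additive] [Pretriangulated C] [MonoidalCategory C]
  {X : Type w}

/-- The first five properties of a support data on the full tensor triangulated subcategory `S`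
of `C` (the cases of interest are `S = ⊤`, i.e. `C` itself, and `S = compactObjects C`) with
values in the set `𝒳` of subsets of `X`. Only the values of `V` on objects of `S` matter. -/
structure SupportAxioms (S : ObjectProperty C) (𝒳 : Set (Set X)) (V : C → Set X) : Prop where
  mem : ∀ M, S M → V M ∈ 𝒳
  zero : ∀ M, IsZero M → V M = ∅
  unit : V (𝟙_ C) = Set.univ
  coproduct : ∀ (I : Type v) (M : I → C) (c : Cofan M), Nonempty (IsColimit c) →
    (∀ i, S (M i)) → S c.pt → V c.pt = ⋃ i, V (M i)
  shift : ∀ M, S M → V (M⟦(1 : ℤ)⟧) = V M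
  triangle : ∀ T ∈ distTriang C, S T.obj₁ → S T.obj₂ → S T.obj₃ →
    V T.obj₂ ⊆ V T.obj₁ ∪ V T.obj₃
  tensor : ∀ M N, S M → S N → V (M ⊗ N) = V M ∩ V N

/-- A support data on `S` with values in `𝒳`: in addition `V(M) = V(M*)` for `M` compact. -/
structure IsSupportData (S : ObjectProperty C) (𝒳 : Set (Set X)) (V : C → Set X) : Prop
    extends SupportAxioms S 𝒳 V where
  dual : ∀ M M', S M → compactObjects C M → Nonempty (ExactPairing M M') → V M = V M'

/-- Faithfulness property: `V(M) = ∅` if and only if `M = 0`. -/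
def IsFaithfulSupport (S : ObjectProperty C) (V : C → Set X) : Prop :=
  ∀ M, S M → (V M = ∅ ↔ IsZero M)

/-- Realization property: every member of `𝒳` is the support of an object of `S`. -/
def HasRealization (S : ObjectProperty C) (𝒳 : Set (Set X)) (V : C → Set X) : Prop :=
  ∀ W ∈ 𝒳, ∃ M, S M ∧ V M = W

/-- `V'`, defined on all of `C` with specialization closed values, extends `V`, defined on the
compact objects. -/
structure Extends [TopologicalSpace X] (V' V : C → Set X) : Prop where
  supportAxioms : SupportAxioms ⊤ (specializationClosedSubsets X) V'
  eq_of_compact : ∀ M, compactObjects C M → V' M = V M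
  faithful : IsFaithfulSupport (compactObjects C) V → IsFaithfulSupport ⊤ V'

end Support

end TensorTriangular

/-! The homeomorphism sends `x` to the prime `pointIdeal V' x` of compact objects whose support
misses `x`. The core is `SupportAxioms.mem_thickTensorIdeal`: a thick tensor ideal `P` containing
`M` contains every compact `N` with V(N) ⊆ V(M). Complete the evaluation M* ⊗ M ⟶ 𝟙 to a triangle
with third term `Q`. By a triangle identity, M kills the map 𝟙 ⟶ Q, hence also the telescope `L` of
N ⟶ Q ⊗ N ⟶ Q ⊗ Q ⊗ N ⟶ ⋯. Since V(L) ⊆ V(M), the tensor axiom gives V(L) = V(M ⊗ L) = ∅, and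
faithfulness on all of K gives L = 0. As `N` is compact, a finite composite N ⟶ Q^{⊗n} ⊗ N is
already zero. The cone of that composite lies in `P`, so `N` is a retract of an object of `P`.

Given this, a prime `P` is recovered from the least support of a compact object outside `P`: it
exists because X is Noetherian and `P` is prime, it is irreducible by realization, and its generic
point `x` satisfies `pointIdeal V' x = P`. -/

namespace TensorTriangular

/-! ### Maps into a coproduct that factor through finitely many summands -/

section FiniteFactorization

variable {C : Type u} [Category.{v} C] [Preadditive C] {J : Type v} {X : J → C}

/-- The finite sums of morphisms `M ⟶ X j ⟶ c.pt` into the point of a cofan. -/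
def finiteMaps (M : C) (c : Cofan X) : AddSubgroup (M ⟶ c.pt) :=
  AddSubgroup.closure {f | ∃ (j : J) (g : M ⟶ X j), g ≫ c.inj j = f}

lemma comp_inj_mem_finiteMaps {M : C} (c : Cofan X) {j : J} (g : M ⟶ X j) :
    g ≫ c.inj j ∈ finiteMaps M c :=
  AddSubgroup.subset_closure ⟨j, g, rfl⟩

lemma comp_mem_finiteMaps {M N : C} {c : Cofan X} (a : N ⟶ M) {f : M ⟶ c.pt}
    (hf : f ∈ finiteMaps M c) : a ≫ f ∈ finiteMaps N c := by
  induction hf using AddSubgroup.closure_induction with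
  | mem f hf =>
    obtain ⟨j, g, rfl⟩ := hf
    rw [← Category.assoc]
    exact comp_inj_mem_finiteMaps c _
  | zero => simp
  | add f g _ _ hf hg => simpa using add_mem hf hg
  | neg f _ hf => simpa using neg_mem hf

open Classical in
/-- The projection of a coproduct in a preadditive category to one of its summands. -/
noncomputable def cofanProj {c : Cofan X} (hc : IsColimit c) (j : J) : c.pt ⟶ X j :=
  Cofan.IsColimit.desc hc fun i => if h : i = j then eqToHom (by rw [h]) else 0

lemma inj_cofanProj_self {c : Cofan X} (hc : IsColimit c) (j : J) :
    c.inj j ≫ cofanProj hc j = 𝟙 (X j) := by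
  simp [cofanProj]

lemma inj_cofanProj_of_ne {c : Cofan X} (hc : IsColimit c) {i j : J} (h : i ≠ j) :
    c.inj i ≫ cofanProj hc j = 0 := by
  simp [cofanProj, h]

/-- Allowing every larger `G` lets the finite sets of two maps be merged when the maps are added. -/
lemma exists_finset_of_mem_finiteMaps {M : C} {c : Cofan X} (hc : IsColimit c) {f : M ⟶ c.pt}
    (hf : f ∈ finiteMaps M c) :
    ∃ F : Finset J, ∀ G : Finset J, F ⊆ G →
      f = ∑ j ∈ G, (f ≫ cofanProj hc j) ≫ c.inj j := by
  classical
  induction hf using AddSubgroup.closure_induction with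
  | mem f hf =>
    obtain ⟨i, g, rfl⟩ := hf
    refine ⟨{i}, fun G hG => ?_⟩
    rw [Finset.sum_eq_single_of_mem i (hG (Finset.mem_singleton_self i))]
    · simp [inj_cofanProj_self]
    · intro j _ hj
      simp [inj_cofanProj_of_ne hc hj.symm]
  | zero => exact ⟨∅, by simp⟩
  | add f g _ _ hf hg =>
    obtain ⟨F, hF⟩ := hf
    obtain ⟨F', hF'⟩ := hg
    refine ⟨F ∪ F', fun G hG => ?_⟩
    simp only [Preadditive.add_comp, Finset.sum_add_distrib]
    rw [← hF G (Finset.union_subset_left hG), ← hF' G (Finset.union_subset_right hG)]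
  | neg f _ hf =>
    obtain ⟨F, hF⟩ := hf
    refine ⟨F, fun G hG => ?_⟩
    simp only [Preadditive.neg_comp, Finset.sum_neg_distrib]
    rw [← hF G hG]

lemma finite_cofanProj_ne_zero {M : C} {c : Cofan X} (hc : IsColimit c) {f : M ⟶ c.pt}
    (hf : f ∈ finiteMaps M c) : {j | f ≫ cofanProj hc j ≠ 0}.Finite := by
  obtain ⟨F, hF⟩ := exists_finset_of_mem_finiteMaps hc hf
  refine F.finite_toSet.subset fun j hj => ?_
  by_contra hjF
  apply hj
  rw [hF F subset_rfl, Preadditive.sum_comp]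
  refine Finset.sum_eq_zero fun i hi => ?_
  rw [Category.assoc, inj_cofanProj_of_ne hc, comp_zero]
  rintro rfl
  exact hjF hi

/-- The quotient of Hom(M, ∐ Xⱼ) by `finiteMaps` receives zero from each Hom(M, Xⱼ). Since Hom(M, ∐
Xⱼ) is the coproduct of these groups, the quotient map is zero. -/
lemma mem_finiteMaps_of_compact {M : C} (hM : compactObjects C M) {c : Cofan X}
    (hc : IsColimit c) (f : M ⟶ c.pt) : f ∈ finiteMaps M c := by
  have := hM J
  let F := preadditiveCoyoneda.obj (op M)
  have h : IsColimit (F.mapCocone c) := isColimitOfPreserves F hc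
  let q : AddCommGrpCat.of (M ⟶ c.pt) ⟶ AddCommGrpCat.of ((M ⟶ c.pt) ⧸ finiteMaps M c) :=
    AddCommGrpCat.ofHom (QuotientAddGroup.mk' (finiteMaps M c))
  have hq : q = 0 := by
    refine h.hom_ext fun ⟨j⟩ => ?_
    ext g
    exact (QuotientAddGroup.eq_zero_iff _).2 (comp_inj_mem_finiteMaps c g)
  exact (QuotientAddGroup.eq_zero_iff f).1 (ConcreteCategory.congr_hom hq f)

/-- A morphism out of the group of maps to a coproduct, given on the maps to the summands. -/
noncomputable def finiteMapsDesc {M : C} {c : Cofan X} (hc : IsColimit c)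
    (h : ∀ f : M ⟶ c.pt, f ∈ finiteMaps M c) {A : Type v} [AddCommGroup A]
    (φ : ∀ j, (M ⟶ X j) →+ A) : (M ⟶ c.pt) →+ A where
  toFun f := ∑ᶠ j, φ j (f ≫ cofanProj hc j)
  map_zero' := by simp
  map_add' f g := by
    simp only [Preadditive.add_comp, map_add]
    -- A `finsum` with infinite support is 0 by convention, so additivity rests on the finiteness
    -- supplied by `h`.
    refine finsum_add_distrib ((finite_cofanProj_ne_zero hc (h f)).subset fun j hj h0 => hj ?_)
      ((finite_cofanProj_ne_zero hc (h g)).subset fun j hj h0 => hj ?_)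
    all_goals simp only [h0, map_zero]

lemma finiteMapsDesc_comp_inj {M : C} {c : Cofan X} (hc : IsColimit c)
    (h : ∀ f : M ⟶ c.pt, f ∈ finiteMaps M c) {A : Type v} [AddCommGroup A]
    (φ : ∀ j, (M ⟶ X j) →+ A) {j : J} (g : M ⟶ X j) :
    finiteMapsDesc hc h φ (g ≫ c.inj j) = φ j g := by
  refine (finsum_eq_single _ j fun i hi => ?_).trans ?_
  · simp [inj_cofanProj_of_ne hc hi.symm]
  · simp [inj_cofanProj_self]

end FiniteFactorization

/-! ### Closure properties of compact objects -/

section CompactObjects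

variable {C : Type u} [Category.{v} C] [Preadditive C]

lemma compact_of_forall_mem_finiteMaps {M : C}
    (h : ∀ (J : Type v) (X : J → C) (c : Cofan X), IsColimit c →
      ∀ f : M ⟶ c.pt, f ∈ finiteMaps M c) : compactObjects C M := by
  intro J
  have : ∀ X : J → C, PreservesColimit (Discrete.functor X) (preadditiveCoyoneda.obj (op M)) := by
    refine fun X => ⟨fun {c} hc => ⟨?_⟩⟩
    exact
      { desc s := AddCommGrpCat.ofHom (finiteMapsDesc (c := c) hc (h J X c hc) (A := s.pt)
          fun j => (s.ι.app ⟨j⟩).hom)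
        fac := by
          rintro s ⟨j⟩
          ext g
          exact finiteMapsDesc_comp_inj (c := c) hc (h J X c hc) (A := s.pt) _ g
        uniq := by
          intro s m hm
          ext f
          induction h J X c hc f using AddSubgroup.closure_induction with
          | mem f hf =>
            obtain ⟨j, g, rfl⟩ := hf
            exact (ConcreteCategory.congr_hom (hm ⟨j⟩) g).trans
              (finiteMapsDesc_comp_inj (c := c) hc (h J X c hc) (A := s.pt)
                (fun j => (s.ι.app ⟨j⟩).hom) g).symm
          | zero => exact (map_zero _).trans (map_zero _).symm
          | add f g _ _ hf hg =>
            exact (map_add m.hom f g).trans ((congrArg₂ (· + ·) hf hg).trans (map_add _ f g).symm)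
          | neg f _ hf =>
            exact (map_neg m.hom f).trans ((congrArg (- ·) hf).trans (map_neg _ f).symm) }
  exact preservesColimitsOfShape_of_discrete _

instance : (compactObjects C).IsStableUnderRetracts where
  of_retract {M N} r hN := by
    refine compact_of_forall_mem_finiteMaps fun J X c hc f => ?_
    have := comp_mem_finiteMaps r.i (mem_finiteMaps_of_compact hN hc (r.r ≫ f))
    rwa [← Category.assoc, r.retract, Category.id_comp] at this

/-- Transposing across the adjunction turns a finite sum over summands R(Xⱼ) into one over Xⱼ. This
serves for shifts and for tensoring with a rigid object. -/
lemma compact_obj_of_adjunction {L R : C ⥤ C} [L.Additive] (adj : L ⊣ R)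
    (hR : ∀ J : Type v, PreservesColimitsOfShape (Discrete J) R) {M : C}
    (hM : compactObjects C M) : compactObjects C (L.obj M) := by
  refine compact_of_forall_mem_finiteMaps fun J X c hc f => ?_
  have := hR J
  have hRc : IsColimit (Cofan.mk (R.obj c.pt) fun j => R.map (c.inj j)) :=
    isColimitCofanMkObjOfIsColimit R _ _ hc
  obtain ⟨F, hF⟩ := exists_finset_of_mem_finiteMaps hRc
    (mem_finiteMaps_of_compact hM hRc (adj.homEquiv _ _ f))
  have hF := congrArg (adj.homEquiv _ _).symm (hF F subset_rfl)
  rw [Equiv.symm_apply_apply, Adjunction.homEquiv_counit, Functor.map_sum,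
    Preadditive.sum_comp] at hF
  rw [hF]
  refine sum_mem fun j _ => ?_
  simp only [Functor.map_comp, Category.assoc]
  have := adj.counit.naturality (c.inj j)
  simp only [Functor.comp_map, Functor.id_map] at this
  erw [this]
  simp only [← Category.assoc]
  exact comp_inj_mem_finiteMaps c _

variable [HasShift C ℤ] [∀ n : ℤ, (shiftFunctor C n).Additive]

lemma compact_shift (n : ℤ) {M : C} (hM : compactObjects C M) : compactObjects C (M⟦n⟧) :=
  compact_obj_of_adjunction (L := shiftFunctor C n) (R := shiftFunctor C (-n))
    (shiftEquiv C n).toAdjunction (fun _ => inferInstance) hM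

instance [HasZeroObject C] [Pretriangulated C] : (compactObjects C).IsTriangulated where
  exists_zero := ⟨_, isZero_zero C, compact_of_forall_mem_finiteMaps fun J X c hc f => by
    rw [(isZero_zero C).eq_of_src f 0]
    exact zero_mem _⟩
  isStableUnderShiftBy n := ⟨fun _ hM => compact_shift n hM⟩
  toIsTriangulatedClosed₂ := .mk' fun T hT h₁ h₃ => by
    refine compact_of_forall_mem_finiteMaps fun J X c hc f => ?_
    obtain ⟨F, hF⟩ := exists_finset_of_mem_finiteMaps hc
      (mem_finiteMaps_of_compact h₁ hc (T.mor₁ ≫ f))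
    -- Subtracting the components of `f` in `F` leaves a map that vanishes on `T.obj₁`, hence
    -- factors through the compact `T.obj₃`.
    obtain ⟨g, hg⟩ := Pretriangulated.Triangle.yoneda_exact₂ T hT
      (f - ∑ j ∈ F, (f ≫ cofanProj hc j) ≫ c.inj j) (by
        rw [Preadditive.comp_sub, sub_eq_zero, Preadditive.comp_sum]
        simpa only [Category.assoc] using hF F subset_rfl)
    rw [sub_eq_iff_eq_add] at hg
    rw [hg]
    exact add_mem (comp_mem_finiteMaps _ (mem_finiteMaps_of_compact h₃ hc g))
      (sum_mem fun j _ => comp_inj_mem_finiteMaps c _)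

end CompactObjects

/-! ### The shift map on the coproduct of a sequence -/

section Telescope

variable {C : Type u} [Category.{v} C] {A : ℕ → C} (a : ∀ n, A n ⟶ A (n + 1))

/-- The composites `A 0 ⟶ A n` of the morphisms of a sequence. -/
def seqMap : ∀ n, A 0 ⟶ A n
  | 0 => 𝟙 _
  | n + 1 => seqMap n ≫ a n

variable {c : Cofan fun i : ULift.{v} ℕ => A i.down} (hc : IsColimit c)

/-- The endomorphism of the coproduct of the terms of a sequence which is induced by its
morphisms. -/
def telescopeShift : c.pt ⟶ c.pt :=
  Cofan.IsColimit.desc hc fun i => a i.down ≫ c.inj ⟨i.down + 1⟩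

lemma inj_telescopeShift (n : ℕ) :
    c.inj ⟨n⟩ ≫ telescopeShift a hc = a n ≫ c.inj ⟨n + 1⟩ :=
  Cofan.IsColimit.fac hc _ _

variable [Preadditive C]

lemma telescopeShift_cofanProj_zero : telescopeShift a hc ≫ cofanProj hc ⟨0⟩ = 0 := by
  refine Cofan.IsColimit.hom_ext hc _ _ fun ⟨i⟩ => ?_
  rw [← Category.assoc, inj_telescopeShift, Category.assoc, inj_cofanProj_of_ne hc (by simp),
    comp_zero, comp_zero]

lemma telescopeShift_cofanProj_succ (n : ℕ) :
    telescopeShift a hc ≫ cofanProj hc ⟨n + 1⟩ = cofanProj hc ⟨n⟩ ≫ a n := by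
  refine Cofan.IsColimit.hom_ext hc _ _ fun ⟨i⟩ => ?_
  rw [← Category.assoc, inj_telescopeShift, Category.assoc, ← Category.assoc (c.inj _)]
  by_cases h : i = n
  · subst h
    rw [inj_cofanProj_self hc, inj_cofanProj_self hc, Category.comp_id, Category.id_comp]
  · rw [inj_cofanProj_of_ne hc (by simpa using h), inj_cofanProj_of_ne hc (by simpa using h),
      comp_zero, zero_comp]

/-- The equation says g = inj₀ + g ≫ shift. Comparing components determines each from the preceding
one, starting with the identity. -/
lemma comp_cofanProj_eq_seqMap {g : A 0 ⟶ c.pt}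
    (hg : g ≫ (𝟙 _ - telescopeShift a hc) = c.inj ⟨0⟩) (n : ℕ) :
    g ≫ cofanProj hc ⟨n⟩ = seqMap a n := by
  have hg' : g = c.inj ⟨0⟩ + g ≫ telescopeShift a hc := by
    rw [← hg, Preadditive.comp_sub, Category.comp_id, sub_add_cancel]
  induction n with
  | zero =>
    rw [hg', Preadditive.add_comp, Category.assoc, telescopeShift_cofanProj_zero,
      inj_cofanProj_self hc, comp_zero, add_zero, seqMap]
  | succ n ih =>
    rw [hg', Preadditive.add_comp, Category.assoc, telescopeShift_cofanProj_succ,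
      inj_cofanProj_of_ne hc (by simp), zero_add, ← Category.assoc, ih, seqMap]

lemma exists_seqMap_eq_zero (hA : compactObjects C (A 0))
    [IsIso (𝟙 c.pt - telescopeShift a hc)] : ∃ n, seqMap a n = 0 := by
  have hg : (c.inj ⟨0⟩ ≫ inv (𝟙 c.pt - telescopeShift a hc)) ≫
      (𝟙 c.pt - telescopeShift a hc) = c.inj ⟨0⟩ := by
    rw [Category.assoc, IsIso.inv_hom_id, Category.comp_id]
  have := (finite_cofanProj_ne_zero hc
    (mem_finiteMaps_of_compact hA hc (c.inj ⟨0⟩ ≫ inv (𝟙 c.pt - telescopeShift a hc))))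
  -- Only finitely many components are nonzero, while the index set is infinite.
  obtain ⟨⟨n⟩, hn⟩ := this.exists_notMem
  refine ⟨n, ?_⟩
  rw [← comp_cofanProj_eq_seqMap a hc hg n]
  simpa using hn

lemma map_telescopeShift_eq_zero {F : C ⥤ C} [F.Additive]
    [PreservesColimitsOfShape (Discrete (ULift.{v} ℕ)) F] (ha : ∀ n, F.map (a n) = 0) :
    F.map (telescopeShift a hc) = 0 := by
  have hFc : IsColimit (Cofan.mk (F.obj c.pt) fun j => F.map (c.inj j)) :=
    isColimitCofanMkObjOfIsColimit F _ _ hc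
  refine Cofan.IsColimit.hom_ext hFc _ _ fun ⟨i⟩ => ?_
  refine (F.map_comp _ _).symm.trans ?_
  rw [inj_telescopeShift, F.map_comp, ha, zero_comp, comp_zero]

end Telescope

/-! ### The telescope as the cone of 1 − shift -/

section TelescopeCone

open Pretriangulated

variable {C : Type u} [Category.{v} C] [Preadditive C] [HasZeroObject C] [HasShift C ℤ]
  [∀ n : ℤ, (shiftFunctor C n).Additive] [Pretriangulated C]
  {A : ℕ → C} (a : ∀ n, A n ⟶ A (n + 1))
  {c : Cofan fun i : ULift.{v} ℕ => A i.down} (hc : IsColimit c)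

/-- `F` kills the shift map, so it sends 1 − shift to the identity, whose cone is zero. -/
lemma isZero_map_telescope {F : C ⥤ C} [F.CommShift ℤ] [F.IsTriangulated]
    [PreservesColimitsOfShape (Discrete (ULift.{v} ℕ)) F] (ha : ∀ n, F.map (a n) = 0)
    {L : C} {p : c.pt ⟶ L} {q : L ⟶ c.pt⟦(1 : ℤ)⟧}
    (hL : Triangle.mk (𝟙 c.pt - telescopeShift a hc) p q ∈ distTriang C) : IsZero (F.obj L) := by
  refine Triangle.isZero₃_of_isIso₁ _ (F.map_distinguished _ hL) ?_
  have : F.map (𝟙 c.pt - telescopeShift a hc) = 𝟙 _ := by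
    rw [F.map_sub, map_telescopeShift_eq_zero a hc ha, F.map_id, sub_zero]
  change IsIso (F.map (𝟙 c.pt - telescopeShift a hc))
  rw [this]
  infer_instance

lemma exists_seqMap_eq_zero_of_isZero (hA : compactObjects C (A 0))
    {L : C} {p : c.pt ⟶ L} {q : L ⟶ c.pt⟦(1 : ℤ)⟧}
    (hL : Triangle.mk (𝟙 c.pt - telescopeShift a hc) p q ∈ distTriang C) (h : IsZero L) :
    ∃ n, seqMap a n = 0 := by
  have : IsIso (𝟙 c.pt - telescopeShift a hc) := (Triangle.isZero₃_iff_isIso₁ _ hL).1 h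
  exact exists_seqMap_eq_zero a hc hA

end TelescopeCone

/-! ### Formal consequences of the support axioms -/

section SupportAxioms

open Pretriangulated

variable {C : Type u} [Category.{v} C] [Preadditive C] [HasZeroObject C] [HasShift C ℤ]
  [∀ n : ℤ, (shiftFunctor C n).Additive] [Pretriangulated C] [MonoidalCategory C]
  {X : Type w} {𝒳 : Set (Set X)} {V : C → Set X}

/-- Isomorphism invariance is not an axiom; it comes from the triangle axiom, the cone of an
isomorphism being zero. -/
lemma SupportAxioms.eq_of_iso (hV : SupportAxioms ⊤ 𝒳 V) {M N : C} (e : M ≅ N) : V M = V N := by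
  have key : ∀ {M N : C}, (M ≅ N) → V N ⊆ V M := by
    intro M N e
    obtain ⟨Z, p, q, hT⟩ := distinguished_cocone_triangle e.hom
    have hZ : V Z = ∅ := hV.zero _ (Triangle.isZero₃_of_isIso₁ _ hT (Iso.isIso_hom e))
    exact (hV.triangle _ hT trivial trivial trivial).trans_eq
      ((congrArg _ hZ).trans (Set.union_empty _))
  exact (key e.symm).antisymm (key e)

lemma SupportAxioms.biprod (hV : SupportAxioms ⊤ 𝒳 V) (M N : C) : V (M ⊞ N) = V M ∪ V N := by
  let c : Cofan fun i : ULift.{v} Bool => bif i.down then M else N :=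
    Cofan.mk (M ⊞ N) fun
      | ⟨true⟩ => biprod.inl
      | ⟨false⟩ => biprod.inr
  have hc : IsColimit c := Cofan.IsColimit.mk _
    (fun s => biprod.desc (s.inj ⟨true⟩) (s.inj ⟨false⟩))
    (by rintro s ⟨_ | _⟩ <;> simp [c])
    (by
      intro s m hm
      refine biprod.hom_ext' _ _ ?_ ?_
      · simpa [c] using hm ⟨true⟩
      · simpa [c] using hm ⟨false⟩)
  have := hV.coproduct _ _ c ⟨hc⟩ (fun _ => trivial) trivial
  refine this.trans ?_
  ext x
  simp [or_comm]

/-- In a triangulated category a split epimorphism N ⟶ M has a complement, so N ≅ F ⊞ M. -/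
lemma SupportAxioms.subset_of_retract (hV : SupportAxioms ⊤ 𝒳 V) {M N : C} (r : Retract M N) :
    V M ⊆ V N := by
  obtain ⟨F, a, b, hT⟩ := distinguished_cocone_triangle₁ r.r
  have : Epi r.r := (SplitEpi.mk r.i r.retract).epi
  obtain ⟨e, -⟩ := exists_iso_binaryBiproduct_of_distTriang _ hT
    (Triangle.mor₃_eq_zero_of_epi₂ _ hT this)
  exact Set.subset_union_right.trans_eq ((hV.eq_of_iso e).trans (hV.biprod _ _)).symm

lemma SupportAxioms.shift_int (hV : SupportAxioms ⊤ 𝒳 V) (M : C) (n : ℤ) : V (M⟦n⟧) = V M := by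
  have succ (n : ℤ) : V (M⟦n + 1⟧) = V (M⟦n⟧) :=
    (hV.eq_of_iso ((shiftFunctorAdd C n 1).app M)).trans (hV.shift _ trivial)
  induction n with
  | zero => exact hV.eq_of_iso ((shiftFunctorZero C ℤ).app M)
  | succ n ih => rw [succ, ih]
  | pred n ih => rw [← ih, ← succ, sub_add_cancel]

/-- The objects whose support does not contain a given point form a triangulated subcategory. -/
lemma SupportAxioms.isTriangulated_notMem (hV : SupportAxioms ⊤ 𝒳 V) (x : X) :
    ObjectProperty.IsTriangulated (fun M : C => x ∉ V M) where
  exists_zero := ⟨_, isZero_zero C, by simp [hV.zero _ (isZero_zero C)]⟩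
  isStableUnderShiftBy n := ⟨fun M hM => by
    change x ∉ V (M⟦n⟧)
    rwa [hV.shift_int]⟩
  ext₂' T hT h₁ h₃ := ObjectProperty.le_isoClosure _ _ fun h =>
    (hV.triangle T hT trivial trivial trivial h).elim h₁ h₃

lemma SupportAxioms.isStableUnderRetracts_notMem (hV : SupportAxioms ⊤ 𝒳 V) (x : X) :
    ObjectProperty.IsStableUnderRetracts (fun M : C => x ∉ V M) where
  of_retract r hN h := hN (hV.subset_of_retract r h)

end SupportAxioms

/-! ### Duality, and morphisms whose cone lies in an ideal -/

section TensorTriangulated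

open Pretriangulated

variable {C : Type u} [Category.{v} C]

/-- In the triangle F ⟶ M ⟶ N on the zero map, the identity of `M` lifts to `F`, making `M` a
retract of an object of `P`. -/
lemma prop_of_trW_zero [Preadditive C] [HasZeroObject C] [HasShift C ℤ]
    [∀ n : ℤ, (shiftFunctor C n).Additive] [Pretriangulated C]
    {P : ObjectProperty C} [P.IsTriangulated] [P.IsStableUnderRetracts]
    {M N : C} (h : P.trW (0 : M ⟶ N)) : P M := by
  obtain ⟨F, f, g, hT, hF⟩ := (P.trW_iff' _).1 h
  have : Epi f := (Triangle.mor₂_eq_zero_iff_epi₁ _ hT).1 rfl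
  obtain ⟨s, hs⟩ := Triangle.coyoneda_exact₂ _ hT (𝟙 M) comp_zero
  exact P.prop_of_retract { i := s, r := f, retract := hs.symm } hF

variable [MonoidalCategory C]

lemma preservesColimitsOfShape_tensorLeft_left (M M' : C) [ExactPairing M M']
    {J : Type*} [Category* J] : PreservesColimitsOfShape J (tensorLeft M') :=
  have := (tensorLeftAdjunction M M').leftAdjoint_preservesColimits
  inferInstance

lemma preservesColimitsOfShape_tensorLeft_right [SymmetricCategory C] (M M' : C)
    [ExactPairing M M'] {J : Type*} [Category* J] : PreservesColimitsOfShape J (tensorLeft M) :=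
  let _ := BraidedCategory.exactPairing_swap M M'
  preservesColimitsOfShape_tensorLeft_left M' M

variable [Preadditive C] [HasZeroObject C] [HasShift C ℤ]
  [∀ n : ℤ, (shiftFunctor C n).Additive] [Pretriangulated C]

lemma IsTensorTriangulated.additive_tensorLeft (hC : IsTensorTriangulated C) (M : C) :
    (tensorLeft M).Additive := by
  obtain ⟨_, _⟩ := hC.exact_left M
  infer_instance

lemma IsTensorTriangulated.zero_whiskerRight (hC : IsTensorTriangulated C) (M N A : C) :
    (0 : M ⟶ N) ▷ A = 0 := by
  obtain ⟨_, _⟩ := hC.exact_right A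
  exact (tensorRight A).map_zero M N

lemma IsCompactlyGeneratedTTC.compact_tensor [SymmetricCategory C]
    (hC : IsCompactlyGeneratedTTC C) {M N : C}
    (hM : compactObjects C M) (hN : compactObjects C N) : compactObjects C (M ⊗ N) := by
  obtain ⟨M', ⟨_⟩⟩ := hC.rigid M hM
  let _ := BraidedCategory.exactPairing_swap M M'
  have := hC.isTensorTriangulated.additive_tensorLeft M
  exact compact_obj_of_adjunction (tensorLeftAdjunction M' M)
    (fun _ => preservesColimitsOfShape_tensorLeft_left M M') hN

lemma IsCompactlyGeneratedTTC.compact_dual [SymmetricCategory C]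
    (hC : IsCompactlyGeneratedTTC C) (M M' : C)
    [ExactPairing M M'] : compactObjects C M' := by
  have := hC.isTensorTriangulated.additive_tensorLeft M'
  exact ObjectProperty.prop_of_iso _ (ρ_ M') (compact_obj_of_adjunction
    (tensorLeftAdjunction M M') (fun _ => preservesColimitsOfShape_tensorLeft_right M M')
    hC.unit_compact)

/-- A triangle identity exhibits `M ◁ ε_ M M'` as a split epimorphism, and its composite with `M ◁
η` is zero. -/
lemma IsTensorTriangulated.whiskerLeft_eq_zero (hC : IsTensorTriangulated C) (M M' : C)
    [ExactPairing M M'] {Q : C} (η : 𝟙_ C ⟶ Q) (hη : ε_ M M' ≫ η = 0) : M ◁ η = 0 := by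
  have := hC.additive_tensorLeft M
  have h : M ◁ ε_ M M' ≫ M ◁ η = 0 := by
    rw [← whiskerLeft_comp, hη]
    exact (tensorLeft M).map_zero _ _
  have h' := congrArg (fun t => (ρ_ M).hom ≫ (λ_ M).inv ≫ η_ M M' ▷ M ≫ (α_ M M' M).hom ≫ t) h
  have z := ExactPairing.evaluation_coevaluation_assoc M M' (M ◁ η)
  rw [z] at h'
  simpa using h'

/-- Tensoring on the left with an object, followed by a morphism from the unit. -/
def unitWhisker {Q : C} (η : 𝟙_ C ⟶ Q) (A : C) : A ⟶ Q ⊗ A := (λ_ A).inv ≫ η ▷ A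

lemma IsTensorTriangulated.whiskerLeft_unitWhisker_eq_zero (hC : IsTensorTriangulated C) {M Q : C}
    {η : 𝟙_ C ⟶ Q} (hη : M ◁ η = 0) (A : C) : M ◁ unitWhisker η A = 0 := by
  have : M ◁ (η ▷ A) = (α_ M (𝟙_ C) A).inv ≫ (M ◁ η) ▷ A ≫ (α_ M Q A).hom := by simp
  rw [unitWhisker, whiskerLeft_comp, this, hη, hC.zero_whiskerRight, zero_comp, comp_zero,
    comp_zero]

/-- The iterated tensor products `Q ⊗ (Q ⊗ ⋯ ⊗ N)`. -/
def iterTensor (Q N : C) : ℕ → C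
  | 0 => N
  | n + 1 => Q ⊗ iterTensor Q N n

lemma IsCompactlyGeneratedTTC.compact_iterTensor [SymmetricCategory C]
    (hC : IsCompactlyGeneratedTTC C) {Q N : C}
    (hQ : compactObjects C Q) (hN : compactObjects C N) (n : ℕ) :
    compactObjects C (iterTensor Q N n) := by
  induction n with
  | zero => exact hN
  | succ n ih => exact hC.compact_tensor hQ ih

/-- Tensoring the triangle with `A` puts F ⊗ A, an object of the ideal, in the position of the
fibre. -/
lemma IsTensorTriangulated.trW_unitWhisker (hC : IsTensorTriangulated C) {S P : ObjectProperty C}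
    (hP : IsThickTensorIdeal S P) {F Q A : C} (hF : P F) (hA : S A) {ε : F ⟶ 𝟙_ C} {η : 𝟙_ C ⟶ Q}
    {δ : Q ⟶ F⟦(1 : ℤ)⟧} (hT : Triangle.mk ε η δ ∈ distTriang C) : P.trW (unitWhisker η A) := by
  have := hP.isTriangulated
  obtain ⟨_, _⟩ := hC.exact_right A
  have h : P.trW (η ▷ A) := ObjectProperty.trW.mk' P
    ((tensorRight A).map_distinguished _ hT) (hP.tensor_mem F A hF hA)
  exact (MorphismProperty.cancel_left_of_respectsIso _ _ _).2 h

end TensorTriangulated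

/-! ### Thick tensor ideals are determined by supports -/

section Support

open Pretriangulated

variable {C : Type u} [Category.{v} C] [Preadditive C] [HasZeroObject C] [HasShift C ℤ]
  [∀ n : ℤ, (shiftFunctor C n).Additive] [Pretriangulated C] [MonoidalCategory C]
  {X : Type w} {𝒳 : Set (Set X)} {V : C → Set X}

lemma SupportAxioms.iterTensor_subset (hV : SupportAxioms ⊤ 𝒳 V) (Q N : C) (n : ℕ) :
    V (iterTensor Q N n) ⊆ V N := by
  induction n with
  | zero => exact subset_rfl
  | succ n ih =>
    rw [iterTensor, hV.tensor _ _ trivial trivial]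
    exact Set.inter_subset_right.trans ih

lemma SupportAxioms.telescope_subset (hV : SupportAxioms ⊤ 𝒳 V) {A : ℕ → C}
    {c : Cofan fun i : ULift.{v} ℕ => A i.down} (hc : IsColimit c) {L : C} {s : c.pt ⟶ c.pt}
    {p : c.pt ⟶ L} {q : L ⟶ c.pt⟦(1 : ℤ)⟧} (hL : Triangle.mk s p q ∈ distTriang C) :
    V L ⊆ ⋃ n, V (A n) := by
  have h := hV.triangle _ (rot_of_distTriang _ hL) trivial trivial trivial
  have h₂ : V c.pt = ⋃ i : ULift.{v} ℕ, V (A i.down) :=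
    hV.coproduct _ _ c ⟨hc⟩ (fun _ => trivial) trivial
  have h' : V L ⊆ V c.pt ∪ V (c.pt⟦(1 : ℤ)⟧) := h
  rw [hV.shift _ trivial, Set.union_self, h₂] at h'
  exact h'.trans (Set.iUnion_subset fun i => Set.subset_iUnion (fun n => V (A n)) i.down)

/-- Given a faithful support datum on a compactly generated tensor triangulated category, a thick
tensor ideal of compact objects containing `M` contains every compact object whose support lies
in that of `M`. -/
theorem SupportAxioms.mem_thickTensorIdeal [IsTriangulated C] [SymmetricCategory C]
    (hC : IsCompactlyGeneratedTTC C) (hV : SupportAxioms ⊤ 𝒳 V)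
    (hfaithful : IsFaithfulSupport ⊤ V) {P : ObjectProperty C}
    (hP : IsThickTensorIdeal (compactObjects C) P) {M N : C} (hM : P M)
    (hN : compactObjects C N) (hNM : V N ⊆ V M) : P N := by
  have := hP.isTriangulated
  have := hP.isThick
  obtain ⟨M', ⟨_⟩⟩ := hC.rigid M (hP.le _ hM)
  have hM' : compactObjects C M' := hC.compact_dual M M'
  have hF : P (M' ⊗ M) := P.prop_of_iso (β_ M M') (hP.tensor_mem _ _ hM hM')
  obtain ⟨Q, η, δ, hT⟩ := distinguished_cocone_triangle (ε_ M M')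
  have hQ : compactObjects C Q :=
    (compactObjects C).ext_of_isTriangulatedClosed₃ _ hT (hP.le _ hF) hC.unit_compact
  have hη : M ◁ η = 0 := hC.isTensorTriangulated.whiskerLeft_eq_zero M M' η
    (comp_distTriang_mor_zero₁₂ _ hT)
  let A := iterTensor Q N
  let a (n : ℕ) : A n ⟶ A (n + 1) := unitWhisker η (A n)
  have hA (n : ℕ) : compactObjects C (A n) := hC.compact_iterTensor hQ hN n
  have := hC.isCompactlyGenerated.hasCoproducts (ULift.{v} ℕ)
  let c : Cofan fun i : ULift.{v} ℕ => A i.down := colimit.cocone _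
  have hc : IsColimit c := colimit.isColimit _
  -- `L` is in general not compact, which is why the support must be defined and faithful on all of
  -- `C`.
  obtain ⟨L, p, q, hL⟩ := distinguished_cocone_triangle (𝟙 c.pt - telescopeShift a hc)
  obtain ⟨_, _⟩ := hC.isTensorTriangulated.exact_left M
  have : PreservesColimitsOfShape (Discrete (ULift.{v} ℕ)) (tensorLeft M) :=
    preservesColimitsOfShape_tensorLeft_right M M'
  have hML : IsZero (M ⊗ L) := isZero_map_telescope a hc (F := tensorLeft M)
    (fun n => hC.isTensorTriangulated.whiskerLeft_unitWhisker_eq_zero hη (A n)) hL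
  have hLM : V L ⊆ V M := (hV.telescope_subset hc hL).trans
    (Set.iUnion_subset fun n => (hV.iterTensor_subset Q N n).trans hNM)
  have hL₀ : IsZero L := by
    refine (hfaithful L trivial).1 ?_
    rw [← Set.inter_eq_right.2 hLM, ← hV.tensor _ _ trivial trivial, hV.zero _ hML]
  obtain ⟨n, hn⟩ := exists_seqMap_eq_zero_of_isZero a hc (hA 0) hL hL₀
  have htrW (n : ℕ) : P.trW (seqMap a n) := by
    induction n with
    | zero => exact P.trW.id_mem _
    | succ n ih =>
      -- Closure of `P.trW` under composition is an instance of the octahedral axiom.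
      exact P.trW.comp_mem _ _ ih (hC.isTensorTriangulated.trW_unitWhisker hP hF (hA n) hT)
  have h₀ := htrW n
  rw [hn] at h₀
  exact prop_of_trW_zero h₀

end Support

/-! ### The ideal of compact objects supported away from a point -/

section PointIdeal

variable {C : Type u} [Category.{v} C] [Preadditive C] {X : Type w}

/-- The compact objects whose support does not contain the point `x`. -/
def pointIdeal (V : C → Set X) (x : X) : ObjectProperty C :=
  compactObjects C ⊓ fun M => x ∉ V M

lemma pointIdeal_iff (V : C → Set X) (x : X) (M : C) :
    pointIdeal V x M ↔ compactObjects C M ∧ x ∉ V M :=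
  Iff.rfl

/-- An object with support `closure {y}` lies outside the ideal of `y`, and lies in that of `x`
unless `x` is in `closure {y}`. Equal ideals thus force equal closures. -/
lemma injective_pointIdeal [TopologicalSpace X] {V : C → Set X}
    (hX : IsZariskiSpace X)
    (hreal : HasRealization (compactObjects C) (closedSubsets X) V) :
    Function.Injective (pointIdeal V) := by
  have key : ∀ {x y : X}, pointIdeal V x = pointIdeal V y → closure {x} ⊆ closure {y} := by
    intro x y h
    obtain ⟨M, hM, hVM⟩ := hreal (closure {y}) isClosed_closure
    refine closure_minimal (Set.singleton_subset_iff.2 ?_) isClosed_closure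
    by_contra hx
    have hMx : pointIdeal V x M := ⟨hM, by rwa [← hVM] at hx⟩
    rw [h] at hMx
    exact hMx.2 (hVM ▸ subset_closure rfl)
  intro x y h
  exact (hX.existsUnique_genericPoint (closure {x}) isIrreducible_singleton.closure
    isClosed_closure).unique rfl ((key h.symm).antisymm (key h))

end PointIdeal

/-! ### Primes correspond to points -/

section Classification

variable {C : Type u} [Category.{v} C] [Preadditive C] [HasZeroObject C] [HasShift C ℤ]
  [∀ n : ℤ, (shiftFunctor C n).Additive] [Pretriangulated C] [MonoidalCategory C]
  {X : Type w} {𝒳 : Set (Set X)} {V : C → Set X}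

lemma Spc.isClosed_iff {S : ObjectProperty C} (W : Set (Spc S)) :
    IsClosed W ↔ ∃ 𝒞 : Set C, Spc.Z S 𝒞 = W := by
  rw [← isOpen_compl_iff]
  change Wᶜᶜ ∈ Set.range (Spc.Z S) ↔ _
  rw [compl_compl, Set.mem_range]

lemma SupportAxioms.isPrimeIdeal_pointIdeal [SymmetricCategory C]
    (hC : IsCompactlyGeneratedTTC C) (hV : SupportAxioms ⊤ 𝒳 V) (x : X) :
    IsPrimeIdeal (compactObjects C) (pointIdeal V x) where
  le := inf_le_left
  isTriangulated := by
    have := hV.isTriangulated_notMem x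
    have := hV.isStableUnderRetracts_notMem x
    unfold pointIdeal
    infer_instance
  isThick := ⟨fun r h => ⟨(compactObjects C).prop_of_retract r h.1,
    fun hx => h.2 (hV.subset_of_retract r hx)⟩⟩
  tensor_mem M N hM hN := ⟨hC.compact_tensor hM.1 hN, fun hx => hM.2 (by
    rw [hV.tensor _ _ trivial trivial] at hx
    exact hx.1)⟩
  proper := ⟨𝟙_ C, hC.unit_compact, fun h => h.2 (by simp [hV.unit])⟩
  prime M N hM hN h := by
    have hx : x ∉ V M ∩ V N := by
      rw [← hV.tensor _ _ trivial trivial]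
      exact h.2
    by_cases hxM : x ∈ V M
    · exact .inr ⟨hN, fun hxN => hx ⟨hxM, hxN⟩⟩
    · exact .inl ⟨hM, hxM⟩

variable [TopologicalSpace X]

lemma SupportAxioms.exists_pointIdeal_eq [IsTriangulated C] [SymmetricCategory C]
    (hC : IsCompactlyGeneratedTTC C) (hX : IsZariskiSpace X) (hV : SupportAxioms ⊤ 𝒳 V)
    (hclosed : ∀ M, compactObjects C M → IsClosed (V M)) (hfaithful : IsFaithfulSupport ⊤ V)
    (hreal : HasRealization (compactObjects C) (closedSubsets X) V)
    {P : ObjectProperty C} (hP : IsPrimeIdeal (compactObjects C) P) :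
    ∃ x, pointIdeal V x = P := by
  have := hP.isTriangulated
  have := hP.isThick
  have hmem {M N : C} (hM : P M) (hN : compactObjects C N) (h : V N ⊆ V M) : P N :=
    hV.mem_thickTensorIdeal hC hfaithful hP.toIsThickTensorIdeal hM hN h
  have := hX.noetherian
  obtain ⟨⟨W, hW⟩, ⟨M₀, hM₀, hPM₀, hVM₀⟩, hmin⟩ := wellFounded_lt.has_min
    {W : Closeds X | ∃ M, compactObjects C M ∧ ¬ P M ∧ V M = W} (by
      obtain ⟨M, hM, hPM⟩ := hP.proper
      exact ⟨⟨V M, hclosed M hM⟩, M, hM, hPM, rfl⟩)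
  change V M₀ = W at hVM₀
  -- Primality makes the supports of compact objects outside `P` stable under intersection, so the
  -- minimal one is least.
  have hle (M : C) (hM : compactObjects C M) (hPM : ¬ P M) : W ⊆ V M := by
    have hT := hC.compact_tensor hM₀ hM
    have hVT : V (M₀ ⊗ M) = W ∩ V M := by rw [hV.tensor _ _ trivial trivial, hVM₀]
    have h := hmin ⟨V (M₀ ⊗ M), hclosed _ hT⟩
      ⟨_, hT, fun h => (hP.prime _ _ hM₀ hM h).elim hPM₀ hPM, rfl⟩
    by_contra hWM
    refine h (lt_of_le_not_ge ?_ fun h' => ?_)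
    · change V (M₀ ⊗ M) ⊆ W
      exact hVT.trans_subset Set.inter_subset_left
    · have h' : W ⊆ V (M₀ ⊗ M) := h'
      exact hWM ((h'.trans_eq hVT).trans Set.inter_subset_right)
  have hirr : IsIrreducible W := by
    constructor
    · rw [Set.nonempty_iff_ne_empty]
      intro h
      have h₀ : Limits.IsZero M₀ := (hfaithful M₀ trivial).1 (hVM₀.trans h)
      exact hPM₀ (P.prop_of_isZero h₀)
    · rw [isPreirreducible_iff_isClosed_union_isClosed]
      intro Z₁ Z₂ h₁ h₂ hZ
      obtain ⟨N₁, hN₁, rfl⟩ := hreal Z₁ h₁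
      obtain ⟨N₂, hN₂, rfl⟩ := hreal Z₂ h₂
      -- If neither closed set contains `W`, leastness puts `N₁` and `N₂` in `P`; their sum then
      -- forces `M₀` into `P`.
      by_contra! h
      have hP₁ : P N₁ := by_contra fun hn => h.1 (hle _ hN₁ hn)
      have hP₂ : P N₂ := by_contra fun hn => h.2 (hle _ hN₂ hn)
      refine hPM₀ (hmem (M := N₁ ⊞ N₂) (P.ext_of_isTriangulatedClosed₂ _
        (Pretriangulated.binaryBiproductTriangle_distinguished N₁ N₂) hP₁ hP₂) hM₀ ?_)
      rwa [hV.biprod, hVM₀]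
  obtain ⟨x, rfl, -⟩ := hX.existsUnique_genericPoint W hirr hW
  refine ⟨x, funext fun M => propext ⟨fun hM => ?_, fun hM => ⟨hP.le _ hM, fun hx => ?_⟩⟩⟩
  · by_contra hPM
    exact hM.2 (hle M hM.1 hPM (subset_closure rfl))
  · refine hPM₀ (hmem hM hM₀ ?_)
    rw [hVM₀]
    exact closure_minimal (Set.singleton_subset_iff.2 hx) (hclosed _ (hP.le _ hM))

/-- The homeomorphism from a Zariski space to the Balmer spectrum which is given by a faithful
support datum with realization. -/
theorem SupportAxioms.nonempty_homeomorph_spc [IsTriangulated C] [SymmetricCategory C]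
    (hC : IsCompactlyGeneratedTTC C) (hX : IsZariskiSpace X) (hV : SupportAxioms ⊤ 𝒳 V)
    (hclosed : ∀ M, compactObjects C M → IsClosed (V M)) (hfaithful : IsFaithfulSupport ⊤ V)
    (hreal : HasRealization (compactObjects C) (closedSubsets X) V) :
    Nonempty (X ≃ₜ Spc (compactObjects C)) := by
  let f (x : X) : Spc (compactObjects C) := ⟨pointIdeal V x, hV.isPrimeIdeal_pointIdeal hC x⟩
  have hf : Function.Bijective f := by
    refine ⟨fun x y h => injective_pointIdeal hX hreal (congrArg Subtype.val h), fun P => ?_⟩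
    obtain ⟨x, hx⟩ := hV.exists_pointIdeal_eq hC hX hclosed hfaithful hreal P.2
    exact ⟨x, Subtype.ext hx⟩
  have hcont : Continuous f := by
    rw [continuous_iff_isClosed]
    intro W hW
    obtain ⟨𝒞, rfl⟩ := (Spc.isClosed_iff W).1 hW
    -- Non-compact members of `𝒞` lie in no prime and impose no condition.
    have : f ⁻¹' Spc.Z _ 𝒞 = ⋂ M ∈ 𝒞, ⋂ _ : compactObjects C M, V M := by
      ext x
      change (∀ M ∈ 𝒞, ¬ pointIdeal V x M) ↔ _
      simp [pointIdeal_iff]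
    rw [this]
    exact isClosed_biInter fun M _ => isClosed_iInter fun hM => hclosed M hM
  have hmap : IsClosedMap f := by
    intro W hW
    obtain ⟨M, hM, rfl⟩ := hreal W hW
    -- The image of V(M) is exactly Z({M}), and by realization every closed set is some V(M).
    refine (Spc.isClosed_iff _).2 ⟨{M}, Set.ext fun P => ?_⟩
    obtain ⟨x, rfl⟩ := hf.2 P
    rw [hf.1.mem_set_image]
    change (∀ N ∈ ({M} : Set C), ¬ pointIdeal V x N) ↔ _
    simp [pointIdeal_iff, hM]
  exact ⟨(Equiv.ofBijective f hf).toHomeomorphOfContinuousClosed hcont hmap⟩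

end Classification

end TensorTriangular

theorem theoremK {C : Type u} [Category.{v} C] [Preadditive C] [HasZeroObject C] [HasShift C ℤ]
    [∀ n : ℤ, (shiftFunctor C n).Additive] [Pretriangulated C] [IsTriangulated C]
    [MonoidalCategory C] [SymmetricCategory C]
    (hC : TensorTriangular.IsCompactlyGeneratedTTC C)
    {X : Type w} [TopologicalSpace X] (hX : TensorTriangular.IsZariskiSpace X)
    (V : C → Set X)
    (hV : TensorTriangular.IsSupportData (TensorTriangular.compactObjects C)
      (TensorTriangular.closedSubsets X) V)
    (hfaithful : TensorTriangular.IsFaithfulSupport (TensorTriangular.compactObjects C) V)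
    (hrealization : TensorTriangular.HasRealization (TensorTriangular.compactObjects C)
      (TensorTriangular.closedSubsets X) V)
    (V' : C → Set X)
    (hV' : TensorTriangular.IsSupportData ⊤ (TensorTriangular.specializationClosedSubsets X) V')
    (hext : TensorTriangular.Extends V' V) :
    Nonempty (X ≃ₜ TensorTriangular.Spc (TensorTriangular.compactObjects C)) := by
  refine hV'.toSupportAxioms.nonempty_homeomorph_spc hC hX (fun M hM => ?_)
    (hext.faithful hfaithful) fun W hW => ?_
  · rw [hext.eq_of_compact M hM]
    exact hV.mem M hM
  · obtain ⟨M, hM, hVM⟩ := hrealization W hW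
    exact ⟨M, hM, (hext.eq_of_compact M hM).trans hVM⟩
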